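/- **Lemma.** For a class $\mathcal F$ of measurable functions on a measurable space $S$ and a probability measure $Q$ on $S$, let $N(\mathcal F,L_2(Q),\varepsilon)$ be the least number of open $L_2(Q)$-balls of radius at most $\varepsilon$, centred in $\mathcal F$, that cover $\mathcal F$. The class $\mathcal F$ is of *VC type* with respect to a measurable envelope $F$ (that is, $|u(s)|\le F(s)$ for all $s\in S$, $u\in\mathcal F$), with constants $A,v\ge 0$, if for every probability measure $Q$ on $S$ $$N(\mathcal F,L_2(Q),\varepsilon)\le\Big(\frac{A\|F\|_{L_2(Q)}}{\varepsilon}\Big)^{v},\qquad 0<\varepsilon\le 2\sup_{u,w\in\mathcal F}\|u-w\|_{L_2(Q)} .$$ Let $K(t)=\Phi(\|t\|^2)$, $t\in\mathbb R^d$, where $\Phi:[0,\infty)\to\mathbb R$ is bounded, vanishes outside $[0,T]$ for some $T<\infty$, has bounded variation, and is left continuous or right continuous. Let $\|\Phi\|_V$ be the total variation of $\Phi$ on $[0,\infty)$. Let $f$ be a bounded probability density on $\mathbb R^d$, and let $\gamma_h(x)=\alpha(x)/(1+h^2\beta(x))$, where $\alpha,\beta:\mathbb R^d\to\mathbb R$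 are continuous and bounded and $\alpha$ is bounded away from zero. Let $\mathcal G$ be a class of measurable functions on $\mathbb R^d$ of VC type with respect to a constant envelope $G$, with constants $A_1,v_1\ge 0$, and let $$\mathcal K=\Big\{x\mapsto K\Big(\frac{t-x}{h}\,\gamma_h(x)\Big)g(x)\;:\; t\in\mathbb R^d,\ 0<h<(2\|\beta\|_\infty)^{-1/2},\ g\in\mathcal G\Big\}$$ (with no upper bound on $h$ if $\beta\equiv0$). Then $\mathcal K$ is a class of measurable functions bounded by $\|\Phi\|_VG$, and for every Borel probability measure $Q$ on $\mathbb R^d$ and every $0<\varepsilon\le 2\sup_{u,w\in\mathcal K}\|u-w\|_{L_2(Q)}$, $$N(\mathcal K,L_2(Q),\varepsilon)\le\Big(\frac{(R\vee A_1)\,\|\Phi\|_V G}{\varepsilon}\Big)^{8d+20+v_1},\qquad R=R_0\,(1+v_1),$$ and also $$N(\mathcal K,L_2(Q),\varepsilon)\le\Big(\frac{(R_0\vee\sqrt6A_1)\,\|\Phi\|_V G}{\varepsilon}\Big)^{8d+20+v_1},$$ where $R_0>0$ is a universal constant, the same in both bounds; it does not depend on $d,K,f,\alpha,\beta,\mathcal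 G,G,A_1,v_1,Q,\varepsilon$. That is, $\mathcal K$ is of VC type with respect to the constant envelope $\|\Phi\|_VG$, with constants independent of $f$. -/

import Mathlib

open MeasureTheory Set
open scoped ENNReal

noncomputable section

/-- The covering number `N(𝒦, L₂(Q), ε)` of the pseudo-metric space `(𝒦, L₂(Q))`: the least number
of open `L₂(Q)`-balls of radius `ε`, centred at points of `𝒦`, that cover `𝒦` (`⊤` if no finite
number suffices). Allowing radii smaller than `ε` does not change it. -/
def l2CoveringNumber {S : Type*} [MeasurableSpace S] (𝒦 : Set (S → ℝ)) (Q : Measure S)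
    (ε : ℝ) : ℕ∞ :=
  ⨅ C ∈ {C : Finset (S → ℝ) | (C : Set (S → ℝ)) ⊆ 𝒦 ∧
      ∀ u ∈ 𝒦, ∃ c ∈ C, eLpNorm (u - c) 2 Q < ENNReal.ofReal ε}, (C.card : ℕ∞)

/-- The diameter `sup_{u, w ∈ 𝒦} ‖u - w‖_{L₂(Q)}`. -/
def l2Diam {S : Type*} [MeasurableSpace S] (𝒦 : Set (S → ℝ)) (Q : Measure S) : ℝ≥0∞ :=
  ⨆ u ∈ 𝒦, ⨆ w ∈ 𝒦, eLpNorm (u - w) 2 Q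

/-- A class `𝒦` of measurable functions is of VC type with respect to the measurable envelope `F`,
with characteristic constants `A` and `v`. -/
structure IsVCType {S : Type*} [MeasurableSpace S] (𝒦 : Set (S → ℝ)) (F : S → ℝ)
    (A v : ℝ) : Prop where
  measurable_mem : ∀ u ∈ 𝒦, Measurable u
  measurable_envelope : Measurable F
  le_envelope : ∀ u ∈ 𝒦, ∀ s, |u s| ≤ F s
  A_nonneg : 0 ≤ A
  v_nonneg : 0 ≤ v
  covering_le : ∀ Q : Measure S, IsProbabilityMeasure Q → ∀ ε : ℝ, 0 < ε →
    ENNReal.ofReal ε ≤ 2 * l2Diam 𝒦 Q →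
    ((l2CoveringNumber 𝒦 Q ε : ℕ∞) : ℝ≥0∞) ≤
      (ENNReal.ofReal A * eLpNorm F 2 Q / ENNReal.ofReal ε) ^ v

/-- The total variation `‖Φ‖_V` of the radial profile `Φ` on its domain `[0, ∞)`. -/
def profileVariation (Φ : ℝ → ℝ) : ℝ := (eVariationOn Φ (Ici 0)).toReal

/-- The hypotheses on the kernel `K(t) = Φ(‖t‖²)`, the density `f`, and the functions `α`, `β`
that enter `γ_h = α / (1 + h² β)`. Only the values of `Φ` on `[0, ∞)` matter. -/
structure KernelAssumptions (d : ℕ) (K : EuclideanSpace ℝ (Fin d) → ℝ) (Φ : ℝ → ℝ)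
    (f α β : EuclideanSpace ℝ (Fin d) → ℝ) : Prop where
  kernel_eq : ∀ t, K t = Φ (‖t‖ ^ 2)
  profile_bounded : ∃ M : ℝ, ∀ s, 0 ≤ s → |Φ s| ≤ M
  profile_support : ∃ T : ℝ, 0 ≤ T ∧ ∀ s, T < s → Φ s = 0
  profile_variation : BoundedVariationOn Φ (Ici 0)
  profile_continuity : (∀ s, 0 ≤ s → ContinuousWithinAt Φ (Icc 0 s) s) ∨
    (∀ s, 0 ≤ s → ContinuousWithinAt Φ (Ici s) s)
  density_measurable : Measurable f
  density_nonneg : ∀ x, 0 ≤ f x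
  density_integral : ∫⁻ x, ENNReal.ofReal (f x) = 1
  density_bounded : ∃ M : ℝ, ∀ x, f x ≤ M
  alpha_continuous : Continuous α
  alpha_bounded : ∃ M : ℝ, ∀ x, |α x| ≤ M
  alpha_away : ∃ c : ℝ, 0 < c ∧ ∀ x, c ≤ |α x|
  beta_continuous : Continuous β
  beta_bounded : ∃ M : ℝ, ∀ x, |β x| ≤ M

/-- `γ_h(x) = α(x) / (1 + h² β(x))`. -/
def bandwidthFactor {d : ℕ} (α β : EuclideanSpace ℝ (Fin d) → ℝ) (h : ℝ)
    (x : EuclideanSpace ℝ (Fin d)) : ℝ :=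
  α x / (1 + h ^ 2 * β x)

/-- The class of functions `x ↦ K(((t - x) / h) γ_h(x)) g(x)` for `t ∈ ℝᵈ`, `g ∈ 𝒢` and
`0 < h < 1 / (2‖β‖_∞)^{1/2}`. The upper bound on `h` is written as `2 h² ‖β‖_∞ < 1`, so that it
is no restriction when `β = 0`. -/
def kernelClass {d : ℕ} (K α β : EuclideanSpace ℝ (Fin d) → ℝ)
    (𝒢 : Set (EuclideanSpace ℝ (Fin d) → ℝ)) : Set (EuclideanSpace ℝ (Fin d) → ℝ) :=
  {u | ∃ (t : EuclideanSpace ℝ (Fin d)) (h : ℝ) (g : EuclideanSpace ℝ (Fin d) → ℝ),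
    0 < h ∧ 2 * h ^ 2 * (⨆ x, |β x|) < 1 ∧ g ∈ 𝒢 ∧
    u = fun x => K ((bandwidthFactor α β h x / h) • (t - x)) * g x}

end

/-! Let `r` be the rescaled squared distance, so that the kernel factor is `Φ ∘ r`; let V be the
total variation of `Φ` and w the cumulative variation of `Φ` divided by V. Since |Φ(a) - Φ(b)| ≤ V
|w(a) - w(b)| and w takes values in [0, 1], the squared L₂ distance of two kernel factors is at most
V² times the L₁ distance of the functions w ∘ r. It therefore suffices to pack the latter in L₁.

After clearing denominators, c < r(x) says that a linear functional determined by (t, h) is positive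
at a vector of a (d + 5)-dimensional space determined by (x, c). Hence the subgraphs shatter no d +
6 points, and the monotone w preserves this (`PseudoDimLE.of_linear`). Greedy choice of separating
points and Sauer–Shelah bound an η-separated family in L₁ by e (4/η)^(2D)
(`PseudoDimLE.card_le_of_separated`); η = (δ/V)² turns this into e (2V/δ)^(4D) for L₂ balls of
radius δ, with D = d + 5.

Finally, a cover of the kernel factors at radius θε/G and one of `𝒢` at radius (1 - θ)ε/V multiply
to an ε-cover of the products. The two choices θ = 1/(2 + v₁) and θ = 1/2 give the two bounds. -/

/-! ### Packing families with subgraphs of bounded VC dimension -/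

/-- As y ≤ 1, y^D ≤ y^k for k ≤ D, and the binomial theorem sums the rest to (1 + y)^n. Leaving y
free avoids any comparison of n with D. -/
theorem sum_choose_le_exp {D n : ℕ} {y : ℝ} (hy : 0 < y) (hy1 : y ≤ 1) :
    (∑ k ∈ Finset.Iic D, (n.choose k : ℝ)) ≤ (1 / y) ^ D * Real.exp (y * n) := by
  have h1 : (∑ k ∈ Finset.Iic D, (n.choose k : ℝ)) * y ^ D ≤ (1 + y) ^ n := by
    calc (∑ k ∈ Finset.Iic D, (n.choose k : ℝ)) * y ^ D
        ≤ ∑ k ∈ Finset.Iic D, (n.choose k : ℝ) * y ^ k := by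
          rw [Finset.sum_mul]
          refine Finset.sum_le_sum fun k hk => ?_
          exact mul_le_mul_of_nonneg_left
            (pow_le_pow_of_le_one hy.le hy1 (Finset.mem_Iic.1 hk)) (by positivity)
      _ ≤ ∑ k ∈ Finset.range (n + D + 1), (n.choose k : ℝ) * y ^ k := by
          refine Finset.sum_le_sum_of_subset_of_nonneg (fun k hk => ?_) fun _ _ _ => by positivity
          have := Finset.mem_Iic.1 hk
          exact Finset.mem_range.2 (by omega)
      _ = ∑ k ∈ Finset.range (n + 1), (n.choose k : ℝ) * y ^ k := by
          symm
          refine Finset.sum_subset (fun k hk => ?_) fun k _ hk => ?_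
          · have := Finset.mem_range.1 hk
            exact Finset.mem_range.2 (by omega)
          · rw [Nat.choose_eq_zero_of_lt (by simpa using hk)]
            simp
      _ = (1 + y) ^ n := by
          rw [add_comm 1 y, add_pow]
          exact Finset.sum_congr rfl fun k _ => by simp [mul_comm]
  have h2 : (1 + y) ^ n ≤ Real.exp (y * n) := by
    rw [mul_comm, Real.exp_nat_mul]
    exact pow_le_pow_left₀ (by positivity) (by linarith [Real.add_one_le_exp y]) n
  rw [one_div, inv_pow, inv_mul_eq_div, le_div_iff₀ (by positivity)]
  exact h1.trans h2

/-- The subgraphs of the functions `w i` shatter no set of more than `D` points. -/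
def PseudoDimLE {ι X : Type*} (w : ι → X → ℝ) (D : ℕ) : Prop :=
  ∀ p : Fin (D + 1) → X × ℝ, ∃ S : Set (Fin (D + 1)),
    ∀ i, ¬ ∀ k, k ∈ S ↔ (p k).2 < w i (p k).1

/-- Sauer–Shelah for the traces of subgraphs on a finite set that tells them apart. -/
theorem PseudoDimLE.card_le_sum_choose {ι X : Type*} {w : ι → X → ℝ} {D : ℕ}
    (hD : PseudoDimLE w D) (T : Finset ι) (P : Finset (X × ℝ))
    (hP : ∀ i ∈ T, ∀ j ∈ T, i ≠ j → ∃ q ∈ P, ¬ (q.2 < w i q.1 ↔ q.2 < w j q.1)) :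
    T.card ≤ ∑ k ∈ Finset.Iic D, P.card.choose k := by
  classical
  let tr : ι → Finset P := fun i => Finset.univ.filter fun q => q.1.2 < w i q.1.1
  have hinj : Set.InjOn tr T := by
    intro i hi j hj hij
    by_contra hne
    obtain ⟨q, hq, hqn⟩ := hP i hi j hj hne
    have := Finset.ext_iff.1 hij ⟨q, hq⟩
    simp only [tr, Finset.mem_filter, Finset.mem_univ, true_and] at this
    exact hqn this
  have hvc : (T.image tr).vcDim ≤ D := by
    refine Finset.sup_le fun s hs => ?_
    by_contra! hcard
    obtain ⟨s', hs', hc⟩ := Finset.exists_subset_card_eq (Nat.succ_le_of_lt hcard)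
    have hsh := (Finset.mem_shatterer.1 hs).mono_right hs'
    let e := (Finset.equivFinOfCardEq hc).symm
    obtain ⟨S, hS⟩ := hD fun k => ((e k).1 : X × ℝ)
    obtain ⟨u, hu, hus⟩ := hsh (t := s'.filter fun q => ∃ k ∈ S, (e k).1 = q)
      (Finset.filter_subset _ _)
    obtain ⟨i, -, rfl⟩ := Finset.mem_image.1 hu
    refine hS i fun k => ?_
    have := Finset.ext_iff.1 hus (e k).1
    simp only [tr, Finset.mem_inter, Finset.mem_filter, Finset.mem_univ, true_and,
      (e k).2] at this
    rw [this]
    constructor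
    · exact fun h => ⟨k, h, rfl⟩
    · rintro ⟨k', hk', he⟩
      rwa [← e.injective (Subtype.ext he)]
  calc T.card = (T.image tr).card := (Finset.card_image_of_injOn hinj).symm
    _ ≤ _ := Finset.card_le_card_shatterer _
    _ ≤ _ := Finset.card_shatterer_le_sum_vcDim
    _ ≤ ∑ k ∈ Finset.Iic D, P.card.choose k := by
      rw [Fintype.card_coe]
      exact Finset.sum_le_sum_of_subset (Finset.Iic_subset_Iic.2 hvc)

-- A uniformly random level in [0, 1] falls between two values with probability equal to their
-- distance; some level does at least as well as the average.
open Classical in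
theorem exists_separating_level {ι : Type*} (w : ι → ℝ) (hw : ∀ i, w i ∈ Icc (0 : ℝ) 1)
    (P : Finset (ι × ι)) :
    ∃ s : ℝ, ∑ q ∈ P, |w q.1 - w q.2| ≤
      ((P.filter fun q => ¬ (s < w q.1 ↔ s < w q.2)).card : ℝ) := by
  -- Half-open because subgraphs are strict: s separates a from b exactly when min a b ≤ s < max a
  -- b.
  let J : ι × ι → Set ℝ := fun q => Ico (min (w q.1) (w q.2)) (max (w q.1) (w q.2))
  let μ : Measure ℝ := volume.restrict (Icc 0 1)
  have : IsProbabilityMeasure μ := ⟨by simp [μ]⟩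
  have hJ : ∀ q, MeasurableSet (J q) := fun q => measurableSet_Ico
  have hint : ∀ q, Integrable ((J q).indicator (1 : ℝ → ℝ)) μ := fun q =>
    (integrable_const (1 : ℝ)).indicator (hJ q)
  have hval : ∀ q, ∫ s, (J q).indicator (1 : ℝ → ℝ) s ∂μ = |w q.1 - w q.2| := by
    intro q
    have hsub : J q ⊆ Icc 0 1 := fun s hs =>
      ⟨(le_min (hw _).1 (hw _).1).trans hs.1, hs.2.le.trans (max_le (hw _).2 (hw _).2)⟩
    rw [integral_indicator_one (hJ q), measureReal_def, Measure.restrict_apply (hJ q),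
      inter_eq_left.2 hsub, Real.volume_Ico, ENNReal.toReal_ofReal (by simp),
      max_sub_min_eq_abs']
  obtain ⟨s, hs⟩ := exists_integral_le
    (integrable_finsetSum P fun q _ => hint q :
      Integrable (fun s => ∑ q ∈ P, (J q).indicator (1 : ℝ → ℝ) s) μ)
  refine ⟨s, ?_⟩
  rw [integral_finsetSum P fun q _ => hint q, Finset.sum_congr rfl fun q _ => hval q] at hs
  refine hs.trans ?_
  rw [Finset.card_filter]
  push_cast
  refine Finset.sum_le_sum fun q _ => ?_
  rw [indicator_apply]
  split_ifs with h1 h2 h2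
  · exact absurd h2 (by
      have := h1.1; have := h1.2
      simp only [min_le_iff, lt_max_iff] at *
      grind)
  · simp
  · simp
  · simp

open Classical in
theorem exists_separating_point {X ι : Type*} [MeasurableSpace X] (Q : Measure X)
    [IsProbabilityMeasure Q] (w : ι → X → ℝ) (hw : ∀ i x, w i x ∈ Icc (0 : ℝ) 1)
    (hm : ∀ i, Measurable (w i)) {η : ℝ} (P : Finset (ι × ι))
    (hP : ∀ q ∈ P, η ≤ ∫ x, |w q.1 x - w q.2 x| ∂Q) :
    ∃ z : X × ℝ, η * P.card ≤
      ((P.filter fun q => ¬ (z.2 < w q.1 z.1 ↔ z.2 < w q.2 z.1)).card : ℝ) := by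
  have hint : ∀ q : ι × ι, Integrable (fun x => |w q.1 x - w q.2 x|) Q := by
    intro q
    refine (Integrable.of_bound ((hm _).sub (hm _)).aestronglyMeasurable 1
      (ae_of_all _ fun x => ?_)).abs
    have := hw q.1 x; have := hw q.2 x
    simp only [Pi.sub_apply, Real.norm_eq_abs, abs_le, mem_Icc] at *
    constructor <;> linarith
  obtain ⟨x, hx⟩ := exists_integral_le
    (integrable_finsetSum P fun q _ => hint q :
      Integrable (fun x => ∑ q ∈ P, |w q.1 x - w q.2 x|) Q)
  obtain ⟨s, hs⟩ := exists_separating_level (fun i => w i x) (fun i => hw i x) P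
  refine ⟨(x, s), le_trans ?_ (hx.trans hs)⟩
  rw [integral_finsetSum P fun q _ => hint q, mul_comm, ← nsmul_eq_mul]
  exact Finset.card_nsmul_le_sum _ _ _ hP

-- Greedy choice: each new point separates at least a fraction η of the pairs that are still
-- unseparated.
open Classical in
theorem exists_finset_few_unseparated {X ι : Type*} [MeasurableSpace X] (Q : Measure X)
    [IsProbabilityMeasure Q] (w : ι → X → ℝ) (hw : ∀ i x, w i x ∈ Icc (0 : ℝ) 1)
    (hm : ∀ i, Measurable (w i)) {η : ℝ} (hη : η ≤ 1) (P : Finset (ι × ι))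
    (hP : ∀ q ∈ P, η ≤ ∫ x, |w q.1 x - w q.2 x| ∂Q) (n : ℕ) :
    ∃ Z : Finset (X × ℝ), Z.card ≤ n ∧
      ((P.filter fun q => ∀ z ∈ Z, (z.2 < w q.1 z.1 ↔ z.2 < w q.2 z.1)).card : ℝ) ≤
        (1 - η) ^ n * P.card := by
  induction n with
  | zero => exact ⟨∅, by simp, by simp⟩
  | succ n ih =>
    obtain ⟨Z, hZ, hc⟩ := ih
    set P' := P.filter fun q => ∀ z ∈ Z, (z.2 < w q.1 z.1 ↔ z.2 < w q.2 z.1) with hP'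
    obtain ⟨z, hz⟩ := exists_separating_point Q w hw hm P'
      fun q hq => hP q (Finset.mem_filter.1 hq).1
    refine ⟨insert z Z, (Finset.card_insert_le _ _).trans (by omega), ?_⟩
    have heq : (P.filter fun q => ∀ y ∈ insert z Z, (y.2 < w q.1 y.1 ↔ y.2 < w q.2 y.1)) =
        P'.filter fun q => (z.2 < w q.1 z.1 ↔ z.2 < w q.2 z.1) := by
      rw [hP', Finset.filter_filter]
      refine Finset.filter_congr fun q _ => ?_
      rw [Finset.forall_mem_insert, and_comm]
    have hadd := Finset.card_filter_add_card_filter_not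
      (s := P') (fun q => (z.2 < w q.1 z.1 ↔ z.2 < w q.2 z.1))
    have hadd' : ((P'.filter fun q => (z.2 < w q.1 z.1 ↔ z.2 < w q.2 z.1)).card : ℝ) +
      ((P'.filter fun q => ¬ (z.2 < w q.1 z.1 ↔ z.2 < w q.2 z.1)).card : ℝ) = P'.card := by
      exact_mod_cast hadd
    rw [heq, pow_succ]
    have := mul_le_mul_of_nonneg_left hc (sub_nonneg.2 hη)
    linarith

/-- The packing bound for a `[0, 1]`-valued family whose subgraphs have VC dimension at most `D`. -/
theorem PseudoDimLE.card_le_of_separated {X ι : Type*} [MeasurableSpace X] (Q : Measure X)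
    [IsProbabilityMeasure Q] {w : ι → X → ℝ} {D : ℕ} (hD : PseudoDimLE w D)
    (hw : ∀ i x, w i x ∈ Icc (0 : ℝ) 1)
    (hm : ∀ i, Measurable (w i)) {η : ℝ} (hη0 : 0 < η) (hη : η ≤ 1) (T : Finset ι)
    (hT : ∀ i ∈ T, ∀ j ∈ T, i ≠ j → η ≤ ∫ x, |w i x - w j x| ∂Q) :
    (T.card : ℝ) ≤ Real.exp 1 * (4 / η) ^ (2 * D) := by
  classical
  have h4 : 1 ≤ 4 / η := by rw [le_div_iff₀ hη0]; linarith
  rcases Nat.eq_zero_or_pos T.card with h0 | hpos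
  · rw [h0]; simp only [Nat.cast_zero]; positivity
  set m : ℝ := (T.card : ℝ) with hmdef
  have hm0 : 0 < m := Nat.cast_pos.2 hpos
  have hm1 : 1 ≤ m := Nat.one_le_cast.2 hpos
  have hlog : 0 ≤ Real.log m := Real.log_nonneg hm1
  -- Just above 2 log m / η, so that (1 - η)^n m² < 1 and no pair is left unseparated.
  let n := ⌊2 * Real.log m / η⌋₊ + 1
  have hn1 : 2 * Real.log m / η < n := by
    simpa [n] using Nat.lt_floor_add_one (2 * Real.log m / η)
  have hn2 : (n : ℝ) ≤ 2 * Real.log m / η + 1 := by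
    have := Nat.floor_le (a := 2 * Real.log m / η) (by positivity)
    simp only [n]; push_cast; linarith
  obtain ⟨Z, hZ, hc⟩ := exists_finset_few_unseparated Q w hw hm hη T.offDiag
    (fun q hq => by
      obtain ⟨h1, h2, h3⟩ := Finset.mem_offDiag.1 hq
      exact hT _ h1 _ h2 h3) n
  have hpow : (1 - η) ^ n * m ^ 2 < 1 := by
    have h1 : (1 - η) ^ n ≤ Real.exp (-(η * n)) := by
      rw [← neg_mul, mul_comm, Real.exp_nat_mul]
      exact pow_le_pow_left₀ (by linarith) (by linarith [Real.add_one_le_exp (-η)]) n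
    have h2 : m ^ 2 = Real.exp (2 * Real.log m) := by
      rw [two_mul, Real.exp_add, Real.exp_log hm0, sq]
    have h3 : 2 * Real.log m < η * n := by
      rwa [div_lt_iff₀ hη0, mul_comm (n : ℝ)] at hn1
    calc (1 - η) ^ n * m ^ 2 ≤ Real.exp (-(η * n)) * m ^ 2 := by gcongr
      _ = Real.exp (-(η * n) + 2 * Real.log m) := by rw [h2, Real.exp_add]
      _ < 1 := by rw [Real.exp_lt_one_iff]; linarith
  have hoff : (T.offDiag.card : ℝ) ≤ m ^ 2 := by
    have : T.offDiag.card ≤ T.card ^ 2 := by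
      rw [Finset.offDiag_card, sq]; exact Nat.sub_le _ _
    rw [hmdef]; exact_mod_cast this
  have hempty : (T.offDiag.filter
      fun q => ∀ z ∈ Z, (z.2 < w q.1 z.1 ↔ z.2 < w q.2 z.1)).card = 0 := by
    have : ((T.offDiag.filter
      fun q => ∀ z ∈ Z, (z.2 < w q.1 z.1 ↔ z.2 < w q.2 z.1)).card : ℝ) < 1 :=
      (hc.trans (mul_le_mul_of_nonneg_left hoff (pow_nonneg (by linarith) n))).trans_lt hpow
    exact_mod_cast Nat.lt_one_iff.1 (by exact_mod_cast this)
  have hcard := hD.card_le_sum_choose T Z fun i hi j hj hij => by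
    by_contra! hcon
    rw [Finset.card_eq_zero] at hempty
    have : (i, j) ∈ T.offDiag.filter
        fun q => ∀ z ∈ Z, (z.2 < w q.1 z.1 ↔ z.2 < w q.2 z.1) :=
      Finset.mem_filter.2 ⟨Finset.mem_offDiag.2 ⟨hi, hj, hij⟩, hcon⟩
    rw [hempty] at this
    simp at this
  -- With y = η/4 the exponential factor costs only √m up to a constant, since n is about 2 log m /
  -- η; this √m is then cancelled against m.
  have hy : 0 < η / 4 := by positivity
  have hsum : m ≤ (4 / η) ^ D * Real.exp (η / 4 * Z.card) := by
    have h := sum_choose_le_exp (D := D) (n := Z.card) hy (by linarith)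
    rw [one_div_div] at h
    exact le_trans (by rw [hmdef]; exact_mod_cast hcard) h
  have hexp : Real.exp (η / 4 * Z.card) ≤ Real.exp (1 / 2) * Real.sqrt m := by
    rw [← Real.exp_log (Real.sqrt_pos.2 hm0), ← Real.exp_add, Real.log_sqrt hm0.le]
    apply Real.exp_le_exp.2
    have hZ' : (Z.card : ℝ) ≤ 2 * Real.log m / η + 1 := le_trans (by exact_mod_cast hZ) hn2
    calc η / 4 * Z.card ≤ η / 4 * (2 * Real.log m / η + 1) := by gcongr
      _ = Real.log m / 2 + η / 4 := by field_simp; ring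
      _ ≤ 1 / 2 + Real.log m / 2 := by linarith
  have hs : Real.sqrt m ≤ (4 / η) ^ D * Real.exp (1 / 2) := by
    have hsq : 0 < Real.sqrt m := Real.sqrt_pos.2 hm0
    refine le_of_mul_le_mul_right ?_ hsq
    calc Real.sqrt m * Real.sqrt m = m := Real.mul_self_sqrt hm0.le
      _ ≤ (4 / η) ^ D * (Real.exp (1 / 2) * Real.sqrt m) :=
        hsum.trans (by gcongr)
      _ = _ := by ring
  calc m = Real.sqrt m ^ 2 := (Real.sq_sqrt hm0.le).symm
    _ ≤ ((4 / η) ^ D * Real.exp (1 / 2)) ^ 2 := by gcongr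
    _ = Real.exp 1 * (4 / η) ^ (2 * D) := by
      rw [mul_pow, ← Real.exp_nat_mul, ← pow_mul, mul_comm D 2]
      norm_num
      ring

/-! ### Shattering and linear dependence -/

/-- More vectors than the dimension satisfy a nontrivial linear relation. A functional positive
exactly where the coefficients are positive would make every term of the relation nonnegative and
one of them positive. -/
theorem exists_realized_set_ne {ι E : Type*} [AddCommGroup E] [Module ℝ E]
    [FiniteDimensional ℝ E] {D : ℕ} (hE : Module.finrank ℝ E ≤ D) (θ : ι → E →ₗ[ℝ] ℝ)
    (φ : Fin (D + 1) → E) :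
    ∃ S : Set (Fin (D + 1)), ∀ i, ¬ ∀ k, k ∈ S ↔ 0 < θ i (φ k) := by
  have hdep : ¬ LinearIndependent ℝ φ := fun h => by
    have := h.fintype_card_le_finrank
    rw [Fintype.card_fin] at this
    omega
  obtain ⟨g, hg, k₀, hk₀⟩ := Fintype.not_linearIndependent_iff.1 hdep
  obtain ⟨l, hl, hl₀⟩ : ∃ l : Fin (D + 1) → ℝ, ∑ k, l k • φ k = 0 ∧ 0 < l k₀ := by
    rcases lt_or_gt_of_ne hk₀ with h | h
    · exact ⟨-g, by simp [hg], by simpa using h⟩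
    · exact ⟨g, hg, h⟩
  refine ⟨{k | 0 < l k}, fun i hi => ?_⟩
  have hsum : ∑ k, l k * θ i (φ k) = 0 := by
    have := congrArg (θ i) hl
    simpa using this
  refine absurd hsum (ne_of_gt (Finset.sum_pos' (fun k _ => ?_) ⟨k₀, Finset.mem_univ _, ?_⟩))
  · by_cases hk : 0 < l k
    · exact (mul_pos hk ((hi k).1 hk)).le
    · exact mul_nonneg_of_nonpos_of_nonpos (not_lt.1 hk) (not_lt.1 fun h => hk ((hi k).2 h))
  · exact mul_pos hl₀ ((hi k₀).1 hl₀)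

theorem PseudoDimLE.of_linear {ι X E : Type*} [AddCommGroup E] [Module ℝ E]
    [FiniteDimensional ℝ E] {D : ℕ} (hE : Module.finrank ℝ E ≤ D) (θ : ι → E →ₗ[ℝ] ℝ)
    (φ : X → ℝ → E) {r : ι → X → ℝ} (hr : ∀ i x c, c < r i x ↔ 0 < θ i (φ x c))
    {W : ℝ → ℝ} (hW : Monotone W) : PseudoDimLE (fun i x => W (r i x)) D := by
  classical
  intro p
  by_contra! hcon
  choose i hi using hcon
  -- A level for W ∘ r must be pulled back to a level for r, though W may have jumps and flat
  -- pieces. Only finitely many indices `i S` matter, and monotonicity puts the values of r outside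
  -- the subgraph strictly below those inside, so some c lies between them.
  have hc : ∀ k, ∃ c, ∀ S, k ∈ S ↔ c < r (i S) (p k).1 := by
    intro k
    let v : Set (Fin (D + 1)) → ℝ := fun S => r (i S) (p k).1
    obtain ⟨c, h1, h2⟩ := Finset.exists_between'
      ((Finset.univ.filter fun S : Set (Fin (D + 1)) => k ∉ S).image v)
      ((Finset.univ.filter fun S : Set (Fin (D + 1)) => k ∈ S).image v) (by
        simp only [Finset.mem_image, Finset.mem_filter, Finset.mem_univ, true_and]
        rintro _ ⟨S, hS, rfl⟩ _ ⟨S', hS', rfl⟩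
        rw [hi S k, not_lt] at hS
        rw [hi S' k] at hS'
        exact hW.reflect_lt (hS.trans_lt hS'))
    refine ⟨c, fun S => ⟨fun hS => h2 _ ?_, fun h => ?_⟩⟩
    · exact Finset.mem_image_of_mem v (by simpa using hS)
    · by_contra hS
      exact (h1 (v S) (Finset.mem_image_of_mem v (by simpa using hS))).not_gt h
  choose c hc using hc
  obtain ⟨S, hS⟩ := exists_realized_set_ne hE θ fun k => φ (p k).1 (c k)
  exact hS (i S) fun k => (hc k S).trans (hr _ _ _)

/-! ### Profiles of bounded variation -/

section Profile

variable {Φ : ℝ → ℝ}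

/-- The variation of `Φ` on `[0, s]`, extended by zero to negative `s`. -/
noncomputable def cumVariation (Φ : ℝ → ℝ) (s : ℝ) : ℝ :=
  variationOnFromTo Φ (Ici 0) 0 (max s 0)

theorem cumVariation_monotone (hΦ : BoundedVariationOn Φ (Ici 0)) :
    Monotone (cumVariation Φ) := fun a b hab =>
  variationOnFromTo.monotoneOn hΦ.locallyBoundedVariationOn self_mem_Ici
    (le_max_right a 0) (le_max_right b 0) (max_le_max_right 0 hab)

theorem cumVariation_mem_Icc (hΦ : BoundedVariationOn Φ (Ici 0)) (s : ℝ) :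
    cumVariation Φ s ∈ Icc 0 (profileVariation Φ) :=
  ⟨variationOnFromTo.nonneg_of_le _ _ (le_max_right _ _),
    (le_abs_self _).trans (variationOnFromTo.abs_le_eVariationOn hΦ)⟩

theorem abs_sub_le_abs_cumVariation_sub (hΦ : BoundedVariationOn Φ (Ici 0)) {a b : ℝ}
    (ha : 0 ≤ a) (hb : 0 ≤ b) : |Φ a - Φ b| ≤ |cumVariation Φ a - cumVariation Φ b| := by
  wlog h : b ≤ a generalizing a b
  · rw [abs_sub_comm, abs_sub_comm (cumVariation Φ a)]
    exact this hb ha (le_of_not_ge h)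
  · refine le_trans ?_ (le_abs_self _)
    simp only [cumVariation, max_eq_left ha, max_eq_left hb]
    exact variationOnFromTo.abs_sub_le_sub_of_le hΦ.locallyBoundedVariationOn self_mem_Ici hb ha h

/-- Jordan decomposition: cumulative variation minus a monotone function. -/
theorem measurable_comp_max_zero (hΦ : BoundedVariationOn Φ (Ici 0)) :
    Measurable fun s => Φ (max s 0) := by
  have h : Monotone fun s => cumVariation Φ s - Φ (max s 0) := fun a b hab =>
    variationOnFromTo.sub_self_monotoneOn hΦ.locallyBoundedVariationOn self_mem_Ici
      (le_max_right a 0) (le_max_right b 0) (max_le_max_right 0 hab)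
  convert (cumVariation_monotone hΦ).measurable.sub h.measurable using 1
  ext s
  simp

theorem abs_le_profileVariation (hΦ : BoundedVariationOn Φ (Ici 0))
    (hT : ∃ T : ℝ, 0 ≤ T ∧ ∀ s, T < s → Φ s = 0) {s : ℝ} (hs : 0 ≤ s) :
    |Φ s| ≤ profileVariation Φ := by
  obtain ⟨T, hT0, hT⟩ := hT
  -- A point beyond the support: the oscillation between it and s is |Φ s|.
  have h0 : Φ (max s (T + 1)) = 0 := hT _ (lt_of_lt_of_le (by linarith) (le_max_right _ _))
  have h := hΦ.dist_le (x := s) (y := max s (T + 1)) hs (hs.trans (le_max_left _ _))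
  rwa [h0, Real.dist_eq, sub_zero] at h

theorem profileVariation_nonneg (Φ : ℝ → ℝ) : 0 ≤ profileVariation Φ := ENNReal.toReal_nonneg

end Profile

/-! ### From packing to covering -/

section Covering

/-- A separated set of greatest cardinality is a net, as an uncovered point could be added to it. -/
theorem exists_maximal_separated {ι : Type*} (close : ι → ι → Prop)
    (hrefl : ∀ i, close i i) (hsymm : ∀ i j, close i j → close j i) {M : ℕ}
    (hM : ∀ T : Finset ι, (∀ i ∈ T, ∀ j ∈ T, i ≠ j → ¬ close i j) → T.card ≤ M) :
    ∃ T : Finset ι, (∀ i ∈ T, ∀ j ∈ T, i ≠ j → ¬ close i j) ∧ ∀ i, ∃ j ∈ T, close i j := by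
  classical
  let p : ℕ → Prop := fun m =>
    ∃ T : Finset ι, (∀ i ∈ T, ∀ j ∈ T, i ≠ j → ¬ close i j) ∧ T.card = m
  obtain ⟨T, hT, hc⟩ : p (Nat.findGreatest p M) :=
    Nat.findGreatest_spec (P := p) (Nat.zero_le M) ⟨∅, by simp, rfl⟩
  refine ⟨T, hT, fun i => ?_⟩
  by_contra! hi
  have hiT : i ∉ T := fun h => hi i h (hrefl i)
  have hT' : ∀ a ∈ insert i T, ∀ b ∈ insert i T, a ≠ b → ¬ close a b := by
    intro a ha b hb hab
    rcases Finset.mem_insert.1 ha with rfl | ha' <;> rcases Finset.mem_insert.1 hb with rfl | hb'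
    · exact absurd rfl hab
    · exact hi b hb'
    · exact fun h => hi a ha' (hsymm _ _ h)
    · exact hT a ha' b hb' hab
  have h1 := Finset.card_insert_of_notMem hiT
  have h2 := Nat.le_findGreatest (P := p) (hM _ hT') ⟨_, hT', rfl⟩
  omega

/-- `L₂` covers of a family of the form `Φ ∘ r i` with `Φ` of bounded variation. -/
theorem exists_cover_of_pseudoDimLE {X ι : Type*} [MeasurableSpace X] (Q : Measure X)
    [IsProbabilityMeasure Q] {Φ : ℝ → ℝ} (hΦ : BoundedVariationOn Φ (Ici 0))
    (hV : 0 < profileVariation Φ) {r : ι → X → ℝ} (hr0 : ∀ i x, 0 ≤ r i x)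
    (hrm : ∀ i, Measurable (r i)) {D : ℕ}
    (hD : PseudoDimLE (fun i x => cumVariation Φ (r i x) / profileVariation Φ) D)
    {δ : ℝ} (hδ : 0 < δ) (hδV : δ ≤ 2 * profileVariation Φ) :
    ∃ T : Finset ι, (T.card : ℝ) ≤ Real.exp 1 * (2 * profileVariation Φ / δ) ^ (4 * D) ∧
      ∀ i, ∃ j ∈ T, eLpNorm ((fun x => Φ (r i x)) - fun x => Φ (r j x)) 2 Q <
        ENNReal.ofReal δ := by
  set V := profileVariation Φ with hVdef
  set w : ι → X → ℝ := fun i x => cumVariation Φ (r i x) / V with hwdef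
  have hw : ∀ i x, w i x ∈ Icc (0 : ℝ) 1 := fun i x => by
    have := cumVariation_mem_Icc hΦ (r i x)
    exact ⟨div_nonneg this.1 hV.le, (div_le_one hV).2 this.2⟩
  have hwm : ∀ i, Measurable (w i) := fun i =>
    ((cumVariation_monotone hΦ).measurable.comp (hrm i)).div_const V
  have hint : ∀ i j, Integrable (fun x => |w i x - w j x|) Q := by
    intro i j
    refine (Integrable.of_bound ((hwm _).sub (hwm _)).aestronglyMeasurable 1
      (ae_of_all _ fun x => ?_)).abs
    have := hw i x; have := hw j x
    simp only [Pi.sub_apply, Real.norm_eq_abs, abs_le, mem_Icc] at *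
    constructor <;> linarith
  -- The passage from L₂ to L₁: a number in [0, 1] dominates its square.
  have hpt : ∀ i j x, (Φ (r i x) - Φ (r j x)) ^ 2 ≤ V ^ 2 * |w i x - w j x| := by
    intro i j x
    have h1 := abs_sub_le_abs_cumVariation_sub hΦ (hr0 i x) (hr0 j x)
    have h2 : |cumVariation Φ (r i x) - cumVariation Φ (r j x)| = V * |w i x - w j x| := by
      have h : cumVariation Φ (r i x) - cumVariation Φ (r j x) = V * (w i x - w j x) := by
        simp only [hwdef]; field_simp
      rw [h, abs_mul, abs_of_pos hV]
    have h3 : |w i x - w j x| ≤ 1 := by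
      have := hw i x; have := hw j x
      simp only [abs_le, mem_Icc] at *
      constructor <;> linarith
    rw [h2] at h1
    calc (Φ (r i x) - Φ (r j x)) ^ 2 = |Φ (r i x) - Φ (r j x)| ^ 2 := (sq_abs _).symm
      _ ≤ (V * |w i x - w j x|) ^ 2 := by gcongr
      _ = V ^ 2 * (|w i x - w j x| * |w i x - w j x|) := by ring
      _ ≤ V ^ 2 * (|w i x - w j x| * 1) := by gcongr
      _ = _ := by ring
  have hsep : ∀ i j, ¬ eLpNorm ((fun x => Φ (r i x)) - fun x => Φ (r j x)) 2 Q <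
      ENNReal.ofReal δ → (δ / V) ^ 2 ≤ ∫ x, |w i x - w j x| ∂Q := by
    intro i j hij
    have h1 : ENNReal.ofReal δ ^ 2 ≤
        eLpNorm ((fun x => Φ (r i x)) - fun x => Φ (r j x)) 2 Q ^ 2 := by
      gcongr; exact not_lt.1 hij
    have h2 : eLpNorm ((fun x => Φ (r i x)) - fun x => Φ (r j x)) 2 Q ^ 2 ≤
        ENNReal.ofReal (V ^ 2 * ∫ x, |w i x - w j x| ∂Q) := by
      have := eLpNorm_nnreal_pow_eq_lintegral (μ := Q) (p := 2) two_ne_zero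
        (f := (fun x => Φ (r i x)) - fun x => Φ (r j x))
      simp only [NNReal.coe_ofNat, ENNReal.coe_ofNat, ENNReal.rpow_ofNat] at this
      rw [this, ← integral_const_mul, ofReal_integral_eq_lintegral_ofReal
        ((hint i j).const_mul _) (ae_of_all _ fun x => by positivity)]
      refine lintegral_mono fun x => ?_
      rw [Pi.sub_apply, ← ofReal_norm, ← ENNReal.ofReal_pow (norm_nonneg _),
        Real.norm_eq_abs, sq_abs]
      exact ENNReal.ofReal_le_ofReal (hpt i j x)
    have h3 := h1.trans h2
    rw [← ENNReal.ofReal_pow hδ.le, ENNReal.ofReal_le_ofReal_iff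
      (mul_nonneg (sq_nonneg _) (integral_nonneg fun _ => abs_nonneg _))] at h3
    rwa [div_pow, div_le_iff₀' (by positivity)]
  have hbase : 1 ≤ 2 * V / δ := by rwa [le_div_iff₀ hδ, one_mul]
  have hbound : ∀ T : Finset ι, (∀ i ∈ T, ∀ j ∈ T, i ≠ j →
      ¬ eLpNorm ((fun x => Φ (r i x)) - fun x => Φ (r j x)) 2 Q < ENNReal.ofReal δ) →
      (T.card : ℝ) ≤ Real.exp 1 * (2 * V / δ) ^ (4 * D) := by
    intro T hT
    by_cases hη : (δ / V) ^ 2 ≤ 1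
    · have := hD.card_le_of_separated Q hw hwm (η := (δ / V) ^ 2) (by positivity) hη T
        fun i hi j hj hij => hsep i j (hT i hi j hj hij)
      convert this using 2
      rw [show 4 * D = 2 * (2 * D) by ring, pow_mul]
      congr 1
      field_simp
      norm_num
    -- Here the separation exceeds 1, the largest possible L₁ distance in a [0, 1]-valued family.
    · have h1 : T.card ≤ 1 := by
        refine Finset.card_le_one.2 fun i hi j hj => ?_
        by_contra hij
        refine hη ((hsep i j (hT i hi j hj hij)).trans ?_)
        have := integral_mono (hint i j) (integrable_const (1 : ℝ)) fun x => by
          have := hw i x; have := hw j x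
          simp only [abs_le, mem_Icc] at *
          constructor <;> linarith
        simpa using this
      calc (T.card : ℝ) ≤ 1 * 1 := by rw [one_mul]; exact_mod_cast h1
        _ ≤ _ := mul_le_mul (Real.one_le_exp zero_le_one) (one_le_pow₀ hbase) zero_le_one
          (Real.exp_pos 1).le
  obtain ⟨T, hT, hcov⟩ := exists_maximal_separated
    (fun i j => eLpNorm ((fun x => Φ (r i x)) - fun x => Φ (r j x)) 2 Q < ENNReal.ofReal δ)
    (fun i => by simpa using hδ) (fun i j h => by rwa [eLpNorm_sub_comm])
    (fun T hT => Nat.le_floor (hbound T hT))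
  exact ⟨T, hbound T hT, hcov⟩

end Covering

/-! ### Covering numbers and products -/

section Covering

variable {S : Type*} [MeasurableSpace S]

theorem l2CoveringNumber_le_card {𝒦 : Set (S → ℝ)} {Q : Measure S} {ε : ℝ} {C : Finset (S → ℝ)}
    (hC : (C : Set (S → ℝ)) ⊆ 𝒦)
    (hcov : ∀ u ∈ 𝒦, ∃ c ∈ C, eLpNorm (u - c) 2 Q < ENNReal.ofReal ε) :
    l2CoveringNumber 𝒦 Q ε ≤ C.card :=
  iInf₂_le (f := fun (C : Finset (S → ℝ)) _ => (C.card : ℕ∞)) C ⟨hC, hcov⟩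

theorem exists_cover_of_l2CoveringNumber_ne_top {𝒦 : Set (S → ℝ)} {Q : Measure S} {ε : ℝ}
    (h : l2CoveringNumber 𝒦 Q ε ≠ ⊤) :
    ∃ C : Finset (S → ℝ), (C : Set (S → ℝ)) ⊆ 𝒦 ∧
      (∀ u ∈ 𝒦, ∃ c ∈ C, eLpNorm (u - c) 2 Q < ENNReal.ofReal ε) ∧
      (C.card : ℕ∞) ≤ l2CoveringNumber 𝒦 Q ε := by
  -- A finite infimum in `ℕ∞` is attained: some cover has fewer than N + 1 elements.
  have hlt : l2CoveringNumber 𝒦 Q ε < l2CoveringNumber 𝒦 Q ε + 1 :=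
    (ENat.lt_add_one_iff h).2 le_rfl
  conv_lhs at hlt => rw [l2CoveringNumber]
  simp only [iInf_lt_iff] at hlt
  obtain ⟨C, hC, hlt⟩ := hlt
  exact ⟨C, hC.1, hC.2, (ENat.lt_add_one_iff h).1 hlt⟩

theorem l2Diam_le_of_abs_le {𝒦 : Set (S → ℝ)} (Q : Measure S) [IsProbabilityMeasure Q] {M : ℝ}
    (hM : ∀ u ∈ 𝒦, ∀ s, |u s| ≤ M) : l2Diam 𝒦 Q ≤ ENNReal.ofReal (2 * M) := by
  refine iSup₂_le fun u hu => iSup₂_le fun w hw => ?_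
  have := eLpNorm_le_of_ae_bound (p := 2) (μ := Q) (f := u - w) (C := 2 * M) (ae_of_all _ fun s => by
    have h1 := hM u hu s; have h2 := hM w hw s
    rw [abs_le] at h1 h2
    rw [Pi.sub_apply, Real.norm_eq_abs, abs_le]
    constructor <;> linarith)
  simpa using this

theorem IsVCType.exists_cover {𝒢 : Set (S → ℝ)} {G A v : ℝ} (h𝒢 : IsVCType 𝒢 (fun _ => G) A v)
    (hne : 𝒢.Nonempty) (hG : 0 ≤ G) (Q : Measure S) [IsProbabilityMeasure Q] {δ : ℝ}
    (hδ : 0 < δ) :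
    ∃ C : Finset (S → ℝ), (C : Set (S → ℝ)) ⊆ 𝒢 ∧
      (∀ u ∈ 𝒢, ∃ c ∈ C, eLpNorm (u - c) 2 Q < ENNReal.ofReal δ) ∧
      (C.card : ℝ) ≤ max 1 ((A * G / δ) ^ v) := by
  have hA := h𝒢.A_nonneg
  rcases le_or_gt (ENNReal.ofReal δ) (2 * l2Diam 𝒢 Q) with hle | hlt
  · have hN := h𝒢.covering_le Q inferInstance δ hδ hle
    rw [eLpNorm_const _ two_ne_zero (IsProbabilityMeasure.ne_zero Q), measure_univ,
      ENNReal.one_rpow, mul_one, Real.enorm_of_nonneg hG, ← ENNReal.ofReal_mul hA,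
      ← ENNReal.ofReal_div_of_pos hδ,
      ENNReal.ofReal_rpow_of_nonneg (by positivity) h𝒢.v_nonneg] at hN
    have hfin : l2CoveringNumber 𝒢 Q δ ≠ ⊤ := by
      rintro h
      rw [h] at hN
      simp at hN
    obtain ⟨C, hC, hcov, hcard⟩ := exists_cover_of_l2CoveringNumber_ne_top hfin
    refine ⟨C, hC, hcov, le_max_of_le_right ?_⟩
    have h1 : ((C.card : ℕ∞) : ℝ≥0∞) ≤ _ := (ENat.toENNReal_le.2 hcard).trans hN
    rw [ENat.toENNReal_coe, ← ENNReal.ofReal_natCast] at h1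
    exact (ENNReal.ofReal_le_ofReal_iff (by positivity)).1 h1
  -- Beyond twice the diameter the VC bound is not available, but a single ball suffices; hence the
  -- maximum with 1.
  · obtain ⟨g, hg⟩ := hne
    refine ⟨{g}, by simpa using hg, fun u hu => ⟨g, by simp, lt_of_le_of_lt ?_ hlt⟩, by simp⟩
    have h1 : eLpNorm (u - g) 2 Q ≤ l2Diam 𝒢 Q :=
      le_iSup₂_of_le u hu (le_iSup₂_of_le g hg le_rfl)
    exact h1.trans (le_mul_of_one_le_left' one_le_two)

theorem eLpNorm_mul_sub_mul_lt {Q : Measure S} {k k' g g' : S → ℝ} (hk : Measurable k)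
    (hk' : Measurable k') (hg : Measurable g) (hg' : Measurable g') {V G δ δ' ε : ℝ}
    (hV : 0 < V) (hG : 0 < G) (hk'V : ∀ x, |k' x| ≤ V) (hgG : ∀ x, |g x| ≤ G)
    (hkk : eLpNorm (k - k') 2 Q < ENNReal.ofReal δ)
    (hgg : eLpNorm (g - g') 2 Q < ENNReal.ofReal δ') (hδ : 0 ≤ δ) (hδ' : 0 ≤ δ')
    (hε : G * δ + V * δ' ≤ ε) :
    eLpNorm ((fun x => k x * g x) - fun x => k' x * g' x) 2 Q < ENNReal.ofReal ε := by
  have heq : ((fun x => k x * g x) - fun x => k' x * g' x) =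
      (k - k') * g + k' * (g - g') := by
    ext x; simp only [Pi.sub_apply, Pi.add_apply, Pi.mul_apply]; ring
  have h1 : eLpNorm ((k - k') * g) 2 Q ≤ ENNReal.ofReal G * eLpNorm (k - k') 2 Q :=
    eLpNorm_le_mul_eLpNorm_of_ae_le_mul (ae_of_all _ fun x => by
      rw [Pi.mul_apply, norm_mul, mul_comm]
      exact mul_le_mul_of_nonneg_right (hgG x) (norm_nonneg _)) 2
  have h2 : eLpNorm (k' * (g - g')) 2 Q ≤ ENNReal.ofReal V * eLpNorm (g - g') 2 Q :=
    eLpNorm_le_mul_eLpNorm_of_ae_le_mul (ae_of_all _ fun x => by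
      rw [Pi.mul_apply, norm_mul]
      exact mul_le_mul_of_nonneg_right (hk'V x) (norm_nonneg _)) 2
  have h3 : ∀ {a : ℝ} {b c : ℝ≥0∞}, 0 < a → b < c →
      ENNReal.ofReal a * b < ENNReal.ofReal a * c := fun ha hbc =>
    (ENNReal.mul_lt_mul_iff_right (by simpa using ha) ENNReal.ofReal_ne_top).2 hbc
  rw [heq]
  calc _ ≤ _ := eLpNorm_add_le ((hk.sub hk').mul hg).aestronglyMeasurable
        (hk'.mul (hg.sub hg')).aestronglyMeasurable one_le_two
    _ ≤ _ := add_le_add h1 h2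
    _ < _ := ENNReal.add_lt_add (h3 hG hkk) (h3 hV hgg)
    _ = ENNReal.ofReal (G * δ + V * δ') := by
      rw [← ENNReal.ofReal_mul hG.le, ← ENNReal.ofReal_mul hV.le,
        ← ENNReal.ofReal_add (by positivity) (by positivity)]
    _ ≤ _ := ENNReal.ofReal_le_ofReal hε

end Covering

/-! ### The radial kernel class -/

section Radial

variable {d : ℕ} {K : EuclideanSpace ℝ (Fin d) → ℝ} {Φ : ℝ → ℝ}
  {f α β : EuclideanSpace ℝ (Fin d) → ℝ}

/-- The squared rescaled distance to which the radial profile is applied. -/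
noncomputable def radialArgument (α β : EuclideanSpace ℝ (Fin d) → ℝ)
    (p : EuclideanSpace ℝ (Fin d) × ℝ) (x : EuclideanSpace ℝ (Fin d)) : ℝ :=
  ‖(bandwidthFactor α β p.2 x / p.2) • (p.1 - x)‖ ^ 2

/-- The pairs `(t, h)` of locations and bandwidths that are admitted in `kernelClass`. -/
abbrev KernelIndex (β : EuclideanSpace ℝ (Fin d) → ℝ) : Type :=
  {p : EuclideanSpace ℝ (Fin d) × ℝ // 0 < p.2 ∧ 2 * p.2 ^ 2 * (⨆ x, |β x|) < 1}

theorem one_add_sq_mul_pos (hβ : ∃ M : ℝ, ∀ x, |β x| ≤ M) (p : KernelIndex β)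
    (x : EuclideanSpace ℝ (Fin d)) : 0 < 1 + p.1.2 ^ 2 * β x := by
  obtain ⟨M, hM⟩ := hβ
  have h1 : |β x| ≤ ⨆ x, |β x| := le_ciSup ⟨M, by rintro _ ⟨y, rfl⟩; exact hM y⟩ x
  have h2 := mul_le_mul_of_nonneg_left ((neg_le_abs (β x)).trans h1) (sq_nonneg p.1.2)
  linarith [p.2.2]

/-- Multiplication by h²(1 + h²β)², positive under the restriction on h, leaves a polynomial
inequality in t, h and c. -/
theorem lt_radialArgument_iff {p : EuclideanSpace ℝ (Fin d) × ℝ} (hp : 0 < p.2)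
    {x : EuclideanSpace ℝ (Fin d)} (hx : 0 < 1 + p.2 ^ 2 * β x) (c : ℝ) :
    c < radialArgument α β p x ↔ 0 < α x ^ 2 * (‖p.1‖ ^ 2 - 2 * inner ℝ p.1 x + ‖x‖ ^ 2) -
      c * (p.2 ^ 2 * (1 + p.2 ^ 2 * β x) ^ 2) := by
  rw [radialArgument, bandwidthFactor, norm_smul, mul_pow, Real.norm_eq_abs, sq_abs, div_div,
    div_pow, div_mul_eq_mul_div, lt_div_iff₀ (by positivity), sub_pos,
    @norm_sub_sq_real _ _ _ p.1 x, mul_pow _ p.2,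
    mul_comm (_ ^ 2) (p.2 ^ 2)]

theorem pseudoDimLE_radialArgument (hβ : ∃ M : ℝ, ∀ x, |β x| ≤ M) {W : ℝ → ℝ}
    (hW : Monotone W) :
    PseudoDimLE (fun (p : KernelIndex β) x => W (radialArgument α β p.1 x)) (d + 5) := by
  -- Each monomial of the polynomial splits into a coefficient in (t, h) and a feature of (x, c): d
  -- features pair with t, and five with 1, ‖t‖², h², h⁴, h⁶.
  let θ : KernelIndex β → (EuclideanSpace ℝ (Fin d) × (Fin 5 → ℝ)) →ₗ[ℝ] ℝ := fun p =>
    { toFun := fun y => -2 * inner ℝ p.1.1 y.1 + ‖p.1.1‖ ^ 2 * y.2 0 + y.2 1 -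
        p.1.2 ^ 2 * y.2 2 - 2 * p.1.2 ^ 4 * y.2 3 - p.1.2 ^ 6 * y.2 4
      map_add' := fun y z => by
        simp only [Prod.fst_add, Prod.snd_add, Pi.add_apply, inner_add_right]; ring
      map_smul' := fun a y => by
        simp only [Prod.smul_fst, Prod.smul_snd, Pi.smul_apply, inner_smul_right, smul_eq_mul,
          RingHom.id_apply]
        ring }
  let φ : EuclideanSpace ℝ (Fin d) → ℝ →
      EuclideanSpace ℝ (Fin d) × (Fin 5 → ℝ) := fun x c =>
    (α x ^ 2 • x, ![α x ^ 2, α x ^ 2 * ‖x‖ ^ 2, c, c * β x, c * β x ^ 2])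
  refine PseudoDimLE.of_linear (by simp) θ φ (fun p x c => ?_) hW
  rw [lt_radialArgument_iff p.2.1 (one_add_sq_mul_pos hβ p x)]
  suffices h : α x ^ 2 * (‖p.1.1‖ ^ 2 - 2 * inner ℝ p.1.1 x + ‖x‖ ^ 2) -
      c * (p.1.2 ^ 2 * (1 + p.1.2 ^ 2 * β x) ^ 2) = θ p (φ x c) by rw [h]
  simp [θ, φ, inner_smul_right]
  ring

theorem measurable_radialArgument (hα : Continuous α) (hβ : Continuous β)
    (p : EuclideanSpace ℝ (Fin d) × ℝ) : Measurable (radialArgument α β p) := by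
  unfold radialArgument bandwidthFactor
  have := hα.measurable
  have := hβ.measurable
  fun_prop

theorem KernelAssumptions.measurable_comp (hK : KernelAssumptions d K Φ f α β)
    (p : EuclideanSpace ℝ (Fin d) × ℝ) : Measurable fun x => Φ (radialArgument α β p x) := by
  have h := (measurable_comp_max_zero hK.profile_variation).comp
    (measurable_radialArgument hK.alpha_continuous hK.beta_continuous p)
  convert h using 2 with x
  rw [Function.comp_apply, max_eq_left (show 0 ≤ radialArgument α β p x from sq_nonneg _)]

theorem KernelAssumptions.kernelClass_eq (hK : KernelAssumptions d K Φ f α β)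
    (𝒢 : Set (EuclideanSpace ℝ (Fin d) → ℝ)) :
    kernelClass K α β 𝒢 =
      {u | ∃ p : KernelIndex β, ∃ g ∈ 𝒢, u = fun x => Φ (radialArgument α β p.1 x) * g x} := by
  ext u
  constructor
  · rintro ⟨t, h, g, hh, hhβ, hg, rfl⟩
    exact ⟨⟨(t, h), hh, hhβ⟩, g, hg, funext fun x => by rw [hK.kernel_eq]; rfl⟩
  · rintro ⟨⟨⟨t, h⟩, hh, hhβ⟩, g, hg, rfl⟩
    exact ⟨t, h, g, hh, hhβ, hg, funext fun x => by rw [hK.kernel_eq]; rfl⟩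

theorem KernelAssumptions.abs_le_of_mem_kernelClass (hK : KernelAssumptions d K Φ f α β)
    {𝒢 : Set (EuclideanSpace ℝ (Fin d) → ℝ)} {G : ℝ} (hG : ∀ g ∈ 𝒢, ∀ x, |g x| ≤ G)
    {u : EuclideanSpace ℝ (Fin d) → ℝ} (hu : u ∈ kernelClass K α β 𝒢)
    (x : EuclideanSpace ℝ (Fin d)) : |u x| ≤ profileVariation Φ * G := by
  rw [hK.kernelClass_eq] at hu
  obtain ⟨p, g, hg, rfl⟩ := hu
  rw [abs_mul]
  exact mul_le_mul (abs_le_profileVariation hK.profile_variation hK.profile_support (sq_nonneg _))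
    (hG g hg x) (abs_nonneg _) (profileVariation_nonneg Φ)

theorem KernelAssumptions.exists_cover (hK : KernelAssumptions d K Φ f α β)
    {𝒢 : Set (EuclideanSpace ℝ (Fin d) → ℝ)} {G A v : ℝ}
    (h𝒢 : IsVCType 𝒢 (fun _ => G) A v) (hne : 𝒢.Nonempty) (hG : 0 < G)
    (hV : 0 < profileVariation Φ) (Q : Measure (EuclideanSpace ℝ (Fin d)))
    [IsProbabilityMeasure Q] {ε θ : ℝ} (hε : 0 < ε) (hεV : ε ≤ 4 * (profileVariation Φ * G))
    (hθ : 0 < θ) (hθ2 : θ ≤ 1 / 2) :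
    ∃ C : Finset (EuclideanSpace ℝ (Fin d) → ℝ),
      (C : Set (EuclideanSpace ℝ (Fin d) → ℝ)) ⊆ kernelClass K α β 𝒢 ∧
      (∀ u ∈ kernelClass K α β 𝒢, ∃ c ∈ C, eLpNorm (u - c) 2 Q < ENNReal.ofReal ε) ∧
      (C.card : ℝ) ≤ Real.exp 1 * (2 / θ * (profileVariation Φ * G / ε)) ^ (4 * (d + 5)) *
        max 1 ((A / (1 - θ) * (profileVariation Φ * G / ε)) ^ v) := by
  classical
  have hΦ := hK.profile_variation
  have hθ1 : 0 < 1 - θ := by linarith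
  -- The radii θε/G and (1 - θ)ε/V give G δ + V δ' = ε. The first is at most 2V because θ ≤ 1/2 and
  -- ε ≤ 4VG.
  obtain ⟨T, hT, hTcov⟩ := exists_cover_of_pseudoDimLE Q hΦ hV
    (r := fun (p : KernelIndex β) x => radialArgument α β p.1 x) (fun _ _ => sq_nonneg _)
    (fun p => measurable_radialArgument hK.alpha_continuous hK.beta_continuous p.1)
    (pseudoDimLE_radialArgument hK.beta_bounded (W := fun s => cumVariation Φ s / profileVariation Φ)
      fun a b hab => div_le_div_of_nonneg_right (cumVariation_monotone hΦ hab) hV.le)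
    (δ := θ * ε / G) (by positivity) (by
      rw [div_le_iff₀ hG]
      nlinarith)
  obtain ⟨C, hC, hCcov, hCcard⟩ := h𝒢.exists_cover hne hG.le Q (δ := (1 - θ) * ε / profileVariation Φ)
    (by positivity)
  rw [hK.kernelClass_eq]
  refine ⟨(T ×ˢ C).image fun q x => Φ (radialArgument α β q.1.1 x) * q.2 x, ?_, ?_, ?_⟩
  · intro u hu
    obtain ⟨q, hq, rfl⟩ := Finset.mem_image.1 (Finset.mem_coe.1 hu)
    exact ⟨q.1, q.2, hC (Finset.mem_product.1 hq).2, rfl⟩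
  · rintro _ ⟨p, g, hg, rfl⟩
    obtain ⟨p', hp', hpp⟩ := hTcov p
    obtain ⟨g', hg', hgg⟩ := hCcov g hg
    refine ⟨_, Finset.mem_image_of_mem _ (Finset.mk_mem_product hp' hg'), ?_⟩
    refine eLpNorm_mul_sub_mul_lt (hK.measurable_comp p.1) (hK.measurable_comp p'.1)
      (h𝒢.measurable_mem g hg) (h𝒢.measurable_mem g' (hC hg')) hV hG
      (fun x => abs_le_profileVariation hΦ hK.profile_support (sq_nonneg _))
      (h𝒢.le_envelope g hg) hpp hgg (by positivity) (by positivity) (le_of_eq ?_)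
    field_simp
    ring
  · calc _ ≤ ((T ×ˢ C).card : ℝ) := by exact_mod_cast Finset.card_image_le
      _ = T.card * C.card := by rw [Finset.card_product]; push_cast; rfl
      _ ≤ _ := mul_le_mul hT hCcard (Nat.cast_nonneg _) (by positivity)
      _ = _ := by
        congr 3
        · field_simp
        · field_simp

end Radial

/-! ### Constants -/

/-- B ≥ 12 and u ≥ 1/4 make the base Bu at least 1, so exponents may be raised. The two stray
factors e are absorbed into the power with exponent 4(d + 5), at the price of one factor e in its
base. -/
theorem exp_mul_pow_mul_max_le {u B x y v : ℝ} (d : ℕ) (hu : 1 / 4 ≤ u) (hB : 12 ≤ B)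
    (hx : 0 ≤ x) (hxB : x * Real.exp 1 ≤ B) (hv : 0 ≤ v)
    (hy : y ≤ Real.exp 1 * (B * u) ^ v) :
    Real.exp 1 * (x * u) ^ (4 * (d + 5)) * max 1 y ≤ (B * u) ^ (8 * d + 20 + v) := by
  have hBu : 1 ≤ B * u := by nlinarith
  have hBu0 : 0 < B * u := by linarith
  have he : 1 ≤ Real.exp 1 := Real.one_le_exp zero_le_one
  have hmax : max 1 y ≤ Real.exp 1 * (B * u) ^ v :=
    max_le (one_le_mul_of_one_le_of_one_le he (Real.one_le_rpow hBu hv)) hy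
  have hexp : Real.exp 1 * Real.exp 1 ≤ Real.exp 1 ^ (4 * (d + 5)) := by
    rw [← sq]; exact pow_le_pow_right₀ he (by omega)
  have hu0 : 0 ≤ u := by linarith
  calc Real.exp 1 * (x * u) ^ (4 * (d + 5)) * max 1 y
      ≤ Real.exp 1 * (x * u) ^ (4 * (d + 5)) * (Real.exp 1 * (B * u) ^ v) := by gcongr
    _ = (Real.exp 1 * Real.exp 1) * (x * u) ^ (4 * (d + 5)) * (B * u) ^ v := by ring
    _ ≤ Real.exp 1 ^ (4 * (d + 5)) * (x * u) ^ (4 * (d + 5)) * (B * u) ^ v := by gcongr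
    _ = (x * Real.exp 1 * u) ^ (4 * (d + 5)) * (B * u) ^ v := by rw [← mul_pow]; ring_nf
    _ ≤ (B * u) ^ (4 * (d + 5)) * (B * u) ^ v := by gcongr
    _ ≤ (B * u) ^ (8 * d + 20) * (B * u) ^ v := by
      gcongr
      omega
    _ = (B * u) ^ (8 * d + 20 + v) := by
      rw [Real.rpow_add hBu0, ← Real.rpow_natCast]
      push_cast
      rfl

theorem one_add_inv_rpow_le_exp {v : ℝ} (hv : 0 ≤ v) :
    (1 + 1 / (1 + v)) ^ v ≤ Real.exp 1 := by
  calc (1 + 1 / (1 + v)) ^ v ≤ Real.exp (1 / (1 + v)) ^ v :=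
        Real.rpow_le_rpow (by positivity)
          (by linarith [Real.add_one_le_exp (1 / (1 + v))]) hv
    _ = Real.exp (1 / (1 + v) * v) := (Real.exp_mul _ _).symm
    _ ≤ Real.exp 1 := by
      refine Real.exp_le_exp.2 ?_
      rw [div_mul_eq_mul_div, one_mul, div_le_one (by positivity)]
      linarith

theorem KernelAssumptions.isVCType_kernelClass {d : ℕ} {K : EuclideanSpace ℝ (Fin d) → ℝ}
    {Φ : ℝ → ℝ} {f α β : EuclideanSpace ℝ (Fin d) → ℝ} (hK : KernelAssumptions d K Φ f α β)
    {𝒢 : Set (EuclideanSpace ℝ (Fin d) → ℝ)} {G A v : ℝ}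
    (h𝒢 : IsVCType 𝒢 (fun _ => G) A v) {B θ : ℝ} (hB : 12 ≤ B) (hθ : 0 < θ) (hθ2 : θ ≤ 1 / 2)
    (hθB : 2 / θ * Real.exp 1 ≤ B)
    (hAB : ∀ u, 0 ≤ u → (A / (1 - θ) * u) ^ v ≤ Real.exp 1 * (B * u) ^ v) :
    IsVCType (kernelClass K α β 𝒢) (fun _ => profileVariation Φ * G) B (8 * d + 20 + v) where
  measurable_mem u hu := by
    rw [hK.kernelClass_eq] at hu
    obtain ⟨p, g, hg, rfl⟩ := hu
    exact (hK.measurable_comp p.1).mul (h𝒢.measurable_mem g hg)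
  measurable_envelope := measurable_const
  le_envelope u hu := hK.abs_le_of_mem_kernelClass h𝒢.le_envelope hu
  A_nonneg := by linarith
  v_nonneg := by have := h𝒢.v_nonneg; positivity
  covering_le Q _ ε hε hle := by
    have hdiam := l2Diam_le_of_abs_le Q
      (fun u hu => hK.abs_le_of_mem_kernelClass h𝒢.le_envelope hu)
    -- The diameter is at most 2VG. This gives u = VG/ε ≥ 1/4, and excludes V = 0 and G = 0.
    have hεV : ε ≤ 4 * (profileVariation Φ * G) := by
      have h := hle.trans (mul_le_mul_right hdiam 2)
      rw [show (2 : ℝ≥0∞) = ENNReal.ofReal 2 by simp, ← ENNReal.ofReal_mul zero_le_two,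
        ENNReal.ofReal_le_ofReal_iff'] at h
      rcases h with h | h <;> linarith
    have hV0 := profileVariation_nonneg Φ
    have hVG : 0 < profileVariation Φ * G := by linarith
    have hV : 0 < profileVariation Φ := lt_of_le_of_ne hV0 fun h => by
      rw [← h, zero_mul] at hVG; exact hVG.false
    have hG : 0 < G := (pos_iff_pos_of_mul_pos hVG).1 hV
    -- An empty class has diameter 0, which leaves no admissible ε > 0.
    have hne : 𝒢.Nonempty := by
      rw [nonempty_iff_ne_empty]
      rintro rfl
      have h0 : l2Diam (kernelClass K α β ∅) Q = 0 := by simp [l2Diam, kernelClass]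
      rw [h0, mul_zero, nonpos_iff_eq_zero, ENNReal.ofReal_eq_zero] at hle
      linarith
    obtain ⟨C, hC, hcov, hcard⟩ := hK.exists_cover h𝒢 hne hG hV Q hε hεV hθ hθ2
    have hu : 1 / 4 ≤ profileVariation Φ * G / ε := by
      rw [le_div_iff₀ hε]; linarith
    have hbound := hcard.trans (exp_mul_pow_mul_max_le d hu hB (by positivity) hθB h𝒢.v_nonneg
      (hAB _ (by linarith)))
    have hv : 0 ≤ 8 * (d : ℝ) + 20 + v := by have := h𝒢.v_nonneg; positivity
    rw [eLpNorm_const _ two_ne_zero (IsProbabilityMeasure.ne_zero Q), measure_univ,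
      ENNReal.one_rpow, mul_one, Real.enorm_of_nonneg hVG.le,
      ← ENNReal.ofReal_mul (by linarith), ← ENNReal.ofReal_div_of_pos hε,
      ENNReal.ofReal_rpow_of_nonneg (by positivity) hv]
    refine (ENat.toENNReal_le.2 (l2CoveringNumber_le_card hC hcov)).trans ?_
    rw [ENat.toENNReal_coe, ← ENNReal.ofReal_natCast, mul_div_assoc]
    exact ENNReal.ofReal_le_ofReal hbound

theorem mainTheorem6 :
    ∃ R : ℝ, 0 < R ∧
      ∀ (d : ℕ) (K : EuclideanSpace ℝ (Fin d) → ℝ) (Φ : ℝ → ℝ)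
        (f α β : EuclideanSpace ℝ (Fin d) → ℝ),
        KernelAssumptions d K Φ f α β →
      ∀ (𝒢 : Set (EuclideanSpace ℝ (Fin d) → ℝ)) (G A₁ v₁ : ℝ),
        IsVCType 𝒢 (fun _ => G) A₁ v₁ →
        IsVCType (kernelClass K α β 𝒢) (fun _ => profileVariation Φ * G)
            (max (R * (1 + v₁)) A₁) (8 * d + 20 + v₁) ∧
        IsVCType (kernelClass K α β 𝒢) (fun _ => profileVariation Φ * G)
            (max R (Real.sqrt 6 * A₁)) (8 * d + 20 + v₁) := by
  refine ⟨12, by norm_num, fun d K Φ f α β hK 𝒢 G A v h𝒢 => ?_⟩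
  have hA := h𝒢.A_nonneg
  have hv := h𝒢.v_nonneg
  have he : Real.exp 1 < 3 := Real.exp_one_lt_three
  constructor
  -- This θ inflates A only by the factor 1 + 1/(1 + v), whose v-th power is at most e; the price is
  -- 2e/θ = 2e(2 + v) ≤ 12(1 + v), as e < 3.
  · have hB := le_max_left (12 * (1 + v)) A
    refine hK.isVCType_kernelClass h𝒢 (θ := 1 / (2 + v)) (by linarith) (by positivity)
      (by gcongr; linarith) ?_ fun u hu => ?_
    · refine le_trans ?_ hB
      rw [div_div_eq_mul_div, div_one]
      nlinarith
    · have h1 : A / (1 - 1 / (2 + v)) * u = (1 + 1 / (1 + v)) * (A * u) := by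
        rw [show 1 - 1 / (2 + v) = (1 + v) / (2 + v) by field_simp; ring]
        field_simp
        ring
      rw [h1, Real.mul_rpow (by positivity) (by positivity)]
      refine mul_le_mul (one_add_inv_rpow_le_exp hv) (Real.rpow_le_rpow (by positivity) ?_ hv)
        (by positivity) (Real.exp_pos 1).le
      gcongr
      exact le_max_right _ _
  -- The even split needs only 4e ≤ 12 but doubles A, and 2 ≤ √6.
  · have hB := le_max_left 12 (Real.sqrt 6 * A)
    refine hK.isVCType_kernelClass h𝒢 (θ := 1 / 2) hB (by norm_num) le_rfl ?_ fun u hu => ?_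
    · refine le_trans ?_ hB
      norm_num
      linarith
    · have h6 : 2 ≤ Real.sqrt 6 := Real.le_sqrt_of_sq_le (by norm_num)
      have hAB : A / (1 - 1 / 2) ≤ max 12 (Real.sqrt 6 * A) :=
        by
        refine le_trans ?_ (le_max_right _ _)
        rw [show A / (1 - 1 / 2) = 2 * A by ring]
        gcongr
      have hA2 : 0 ≤ A / (1 - 1 / 2) := div_nonneg hA (by norm_num)
      refine (Real.rpow_le_rpow (by positivity) (mul_le_mul_of_nonneg_right hAB hu) hv).trans ?_
      exact le_mul_of_one_le_left (by positivity) (Real.one_le_exp zero_le_one)
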